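/- Theorem 1 (The Jordan Curve Theorem in Discrete Space). A discrete surface $S=\langle G,U_2\rangle$ consists of a simple graph $G=(V,E)$ and a set $U_2$ of minimal (chordless) simple cycles of $G$, the 2-cells, such that every vertex lies in a 2-cell, every edge lies in one or two 2-cells, and any two 2-cells are joined by a chain of 2-cells in which consecutive ones share an edge. The boundary $\partial S$ is the set of endpoints of edges that lie in only one 2-cell. $S$ is regular if around each vertex $p$ there are finitely many 2-cells and any two of them are joined by a chain of 2-cells at $p$ in which consecutive ones share an edge at $p$. $S$ is orientable if the 2-cells can be directed so that two different 2-cells never run through a common edge in the same direction; the 2-cells so directed are called clockwise, and they give a clockwise cyclic order of the neighbours of each vertex. Two simple paths $C$, $C'$ cross over each other if, after possibly reversing $C'$, $C=\dots a\,p\,b\dots s\,q\,t\dots$ and $C'=\dots a'\,p\,b\dots s\,q\,t'\dots$ with a common arc from $p$ to $q$ (if $p=q$, then $C=\dots a\,p\,t\dots$, $C'=\dots a'\,p\,t'\dots$ and $b=t$, $s=a$), where $a\neq a'$, $t\ne t'$, and the cycle $a\,p\,a'\dots a$ around $p$ that avoids $b$ and the cycle $q\,t\dots t'\,q$ around $q$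 that avoids $s$ have different orientations. $C$ and $C'$ are gradually varied if the set of edges that belong to exactly one of $C$, $C'$ is the sum modulo 2 of the edge sets of finitely many 2-cells all of whose vertices lie on $C\cup C'$. They are side-gradually varied if they are gradually varied and do not cross over each other. $S$ is simply connected if for every simple cycle $C$ and any two distinct vertices $p,q$ of $C$ there is a finite sequence of simple paths $Q_0,\dots,Q_n$ from $p$ to $q$ such that $Q_0$ and $Q_n$ are the two arcs of $C$ between $p$ and $q$, and $Q_i$, $Q_{i+1}$ are side-gradually varied for $0\le i<n$. A closed discrete curve is a simple cycle of $G$ that does not contain all vertices of any 2-cell. Let $S$ be a discrete surface that is regular, orientable and simply connected, and let $C$ be a closed discrete curve on $S$ that contains no point of $\partial S$. Then $S-C$, the graph obtained from $G$ by deleting the vertices of $C$, has at least two connected components. More precisely, every edge of $C$ lies in two different 2-cells $A$ and $B$, each of $A$ and $B$ has a vertex that is not on $C$, and every path in $G$ from a vertex of $A$ that is not on $C$ to a vertex of $B$ that is not on $C$ contains a vertex of $C$. -/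

import Mathlib

/-- A set `A` of vertices is a *minimal closed curve* of `G` if the edges of `G` between vertices
of `A` form a single simple cycle (so the cycle has no chord, and no proper subset of `A` carries
a cycle). -/
def IsMinimalCycle {V : Type*} (G : SimpleGraph V) (A : Finset V) : Prop :=
  (G.induce (A : Set V)).Connected ∧ ∀ u ∈ A, {v | v ∈ A ∧ G.Adj u v}.ncard = 2

/-- Two vertex sets share a 1-cell (an edge of `G`). -/
def ShareEdge {V : Type*} (G : SimpleGraph V) (A B : Finset V) : Prop :=
  ∃ u v, G.Adj u v ∧ u ∈ A ∧ v ∈ A ∧ u ∈ B ∧ v ∈ B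

/-- A discrete surface `⟨G, U₂⟩`: a simple graph with a set of minimal closed curves, its 2-cells
(given by their vertex sets), such that every vertex lies in a 2-cell, every edge lies in one or
two 2-cells, and any two 2-cells are line-connected, i.e. joined by a chain of 2-cells in which
consecutive ones share an edge. -/
structure DiscreteSurface (V : Type*) where
  /-- the underlying graph: vertices are 0-cells and edges are 1-cells -/
  G : SimpleGraph V
  /-- the 2-cells -/
  cells : Set (Finset V)
  minimal : ∀ A ∈ cells, IsMinimalCycle G A
  vertex_mem : ∀ v, ∃ A ∈ cells, v ∈ A
  edge_mem : ∀ u v, G.Adj u v →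
    {A | A ∈ cells ∧ u ∈ A ∧ v ∈ A}.ncard = 1 ∨ {A | A ∈ cells ∧ u ∈ A ∧ v ∈ A}.ncard = 2
  lineConnected : ∀ A ∈ cells, ∀ B ∈ cells,
    Relation.ReflTransGen (fun A B => A ∈ cells ∧ B ∈ cells ∧ ShareEdge G A B) A B

namespace DiscreteSurface

variable {V : Type*}

/-- The point `p` is *regular*: its neighbourhood is like a disk (or a half-disk, if `p` is on the
boundary), that is, there are finitely many 2-cells at `p` and they are line-connected around `p`,
by chains of 2-cells at `p` in which consecutive ones share an edge at `p`. -/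
def RegularAt (S : DiscreteSurface V) (p : V) : Prop :=
  {A | A ∈ S.cells ∧ p ∈ A}.Finite ∧
  ∀ A ∈ S.cells, p ∈ A → ∀ B ∈ S.cells, p ∈ B →
    Relation.ReflTransGen
      (fun A B => A ∈ S.cells ∧ B ∈ S.cells ∧ ∃ x, S.G.Adj p x ∧ p ∈ A ∧ x ∈ A ∧ p ∈ B ∧ x ∈ B)
      A B

/-- A surface is regular if all its points are. -/
def Regular (S : DiscreteSurface V) : Prop := ∀ p, S.RegularAt p

/-- The boundary `∂S`: the vertices of those edges that lie in only one 2-cell. -/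
def boundary (S : DiscreteSurface V) : Set V :=
  {u | ∃ v, S.G.Adj u v ∧ {A | A ∈ S.cells ∧ u ∈ A ∧ v ∈ A}.ncard = 1}

/-- An orientation of the surface: every 2-cell is a directed cycle (`dir A u v` says that `v`
follows `u` on the 2-cell `A`), and two different 2-cells never run through a common edge in the
same direction. The chosen direction of the 2-cells is called clockwise. -/
structure Orientation (S : DiscreteSurface V) where
  dir : Finset V → V → V → Prop
  mem : ∀ A u v, dir A u v → A ∈ S.cells ∧ u ∈ A ∧ v ∈ A ∧ S.G.Adj u v
  antisymm : ∀ A u v, dir A u v → ¬ dir A v u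
  existsUnique_next : ∀ A ∈ S.cells, ∀ u ∈ A, ∃! v, dir A u v
  existsUnique_prev : ∀ A ∈ S.cells, ∀ v ∈ A, ∃! u, dir A u v
  coherent : ∀ A B u v, A ≠ B → dir A u v → ¬ dir B u v

/-- The surface is orientable. -/
def Orientable (S : DiscreteSurface V) : Prop := Nonempty S.Orientation

variable {S : DiscreteSurface V}

/-- One clockwise step from a neighbour `x` of `p` to the next neighbour `y` of `p` along the
boundary of the neighbourhood `S(p)`: for some 2-cell `A` at `p`, the vertices of `A` other than
`p` are traversed clockwise from `x`, the successor of `p`, to `y`, the predecessor of `p`. -/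
def Orientation.CwStep (O : S.Orientation) (p x y : V) : Prop :=
  ∃ A, O.dir A p x ∧ O.dir A y p

/-- One can go clockwise from `x` to `y` on the boundary of `S(p)` without meeting `z`. -/
def Orientation.CwArc (O : S.Orientation) (p x y z : V) : Prop :=
  x ≠ z ∧ Relation.ReflTransGen (fun u v => O.CwStep p u v ∧ v ≠ z) x y

/-- The three different neighbours `x`, `y`, `z` of `p` come in this clockwise cyclic order around
`p`. (At an inner regular point the last three alternatives are equivalent. At a boundary point the
neighbours form a clockwise row, which is closed up to a cyclic order.) -/
def Orientation.Cw (O : S.Orientation) (p x y z : V) : Prop :=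
  x ≠ y ∧ y ≠ z ∧ z ≠ x ∧ (O.CwArc p x y z ∨ O.CwArc p y z x ∨ O.CwArc p z x y)

/-- Cross-over of two vertex sequences, passing their common arc in the same direction:
`C = … a p b … s q t …` and `C' = … a' p b … s q t' …` have in common exactly the arc `m` from `p`
to `q` (where `p = q` is possible, and then `b = t` and `s = a`), `a ≠ a'`, `t ≠ t'`, and the cycle
`a → p → a' → ⋯ → a` without `b` around `p` and the cycle `q → t → ⋯ → t' → q` without `s` around
`q` have different orientations. The first cycle is clockwise iff `a'`, `a`, `b` is a clockwise
order around `p`, the second iff `t`, `t'`, `s` is a clockwise order around `q`. -/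
def Orientation.CrossOverDirected (O : S.Orientation) (C C' : List V) : Prop :=
  ∃ (m : List V) (a b s t a' t' p q : V),
    (a :: m ++ [t]) <:+: C ∧ (a' :: m ++ [t']) <:+: C' ∧
    [a, p, b] <+: (a :: m ++ [t]) ∧ [s, q, t] <:+ (a :: m ++ [t]) ∧
    a ≠ a' ∧ t ≠ t' ∧
    ((O.Cw p a' a b ∧ O.Cw q t' t s) ∨ (O.Cw p a a' b ∧ O.Cw q t t' s))

/-- Two simple paths cross over each other. A path counts here without its direction of travel, so
the common arc may be passed in the same or in opposite directions. The choice of the orientation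
of `S` does not matter: passing to the opposite one exchanges the two alternatives above. -/
def CrossOver (S : DiscreteSurface V) {p q : V} (P P' : S.G.Walk p q) : Prop :=
  ∃ O : S.Orientation, O.CrossOverDirected P.support P'.support ∨
    O.CrossOverDirected P.support P'.support.reverse

/-- The edges of a 2-cell. -/
def cellEdges (S : DiscreteSurface V) (A : Finset V) : Set (Sym2 V) :=
  {e | e ∈ S.G.edgeSet ∧ ∀ v ∈ e, v ∈ A}

/-- `XorSum(C, C')`, the edges that belong to exactly one of the two paths. -/
def xorSum (S : DiscreteSurface V) {p q : V} (P P' : S.G.Walk p q) : Set (Sym2 V) :=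
  {e | e ∈ P.edges ∧ e ∉ P'.edges} ∪ {e | e ∈ P'.edges ∧ e ∉ P.edges}

/-- Two simple paths are gradually varied: `XorSum(C, C')` is the sum modulo 2 of the edge sets of
finitely many 2-cells, all vertices of which lie on the two paths. -/
def GraduallyVaried (S : DiscreteSurface V) {p q : V} (P P' : S.G.Walk p q) : Prop :=
  ∃ F : Finset (Finset V),
    (∀ A ∈ F, A ∈ S.cells ∧ ∀ x ∈ A, x ∈ P.support ∨ x ∈ P'.support) ∧
    ∀ e, e ∈ S.xorSum P P' ↔ Odd {A | A ∈ F ∧ e ∈ S.cellEdges A}.ncard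

/-- Side-gradually varied: gradually varied and not crossing over each other. -/
def SideGraduallyVaried (S : DiscreteSurface V) {p q : V} (P P' : S.G.Walk p q) : Prop :=
  S.GraduallyVaried P P' ∧ ¬ S.CrossOver P P'

open Classical in
/-- Simply connected: for every simple cycle `C` and any two different points `p`, `q` of it, one
of the two arcs of `C` from `p` to `q` can be deformed to the other by a finite sequence of simple
paths from `p` to `q`, consecutive ones being side-gradually varied. (A simple cycle is written as a
closed walk from `p` to `p`; the first arc follows it up to `q`, the second one is the rest of
it, reversed.) -/
def SimplyConnected (S : DiscreteSurface V) : Prop :=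
  ∀ (p q : V) (C : S.G.Walk p p) (hq : q ∈ C.support), C.IsCycle → p ≠ q →
    ∃ (n : ℕ) (Q : ℕ → S.G.Walk p q),
      (∀ i ≤ n, (Q i).IsPath) ∧
      Q 0 = C.takeUntil q hq ∧ Q n = (C.dropUntil q hq).reverse ∧
      ∀ i < n, S.SideGraduallyVaried (Q i) (Q (i + 1))

/-- A closed discrete curve: a simple cycle that does not contain all vertices of any 2-cell. -/
def IsClosedCurve (S : DiscreteSurface V) {w : V} (C : S.G.Walk w w) : Prop :=
  C.IsCycle ∧ ∀ A ∈ S.cells, ∃ v ∈ A, v ∉ C.support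

/-- `S - C`: the graph that is left when the vertices of `C` are removed. -/
abbrev minus (S : DiscreteSurface V) {w : V} (C : S.G.Walk w w) :
    SimpleGraph {v : V | v ∉ C.support} :=
  S.G.induce {v : V | v ∉ C.support}

end DiscreteSurface

/-!
The proof is homological, with coefficients modulo 2. Simple connectedness deforms one arc of the
curve `C` into the other by steps each of which changes the edge set by a sum of 2-cells; adding up
all the steps exhibits the edge set of `C` as the boundary modulo 2 of a finite set `F` of 2-cells
(`exists_boundsMod2_edges`).

Such an `F` is a two-colouring of the 2-cells. Two different 2-cells with a common edge `e` are the
only ones at `e`, so they have different colours exactly if `e` is an edge of `C`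
(`BoundsMod2.mem_iff_not_mem_iff`). A vertex off `C` is on no edge of `C`, so by regularity all
2-cells around it have one colour; adjacent vertices have a common 2-cell, so the colour is constant
along every walk that avoids `C` (`BoundsMod2.mem_iff_of_walk`). The two 2-cells at an edge of `C`
have different colours, so no such walk leads from one to the other.
-/

namespace DiscreteSurface

variable {V : Type*} {S : DiscreteSurface V}

open Classical in
/-- The set `E` of edges is the sum modulo 2 of the edge sets of the 2-cells in `F`. -/
def BoundsMod2 (S : DiscreteSurface V) (F : Finset (Finset V)) (E : Set (Sym2 V)) : Prop :=
  (∀ A ∈ F, A ∈ S.cells) ∧ ∀ e, e ∈ E ↔ Odd (F.filter fun A => e ∈ S.cellEdges A).card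

lemma BoundsMod2.empty : S.BoundsMod2 ∅ ∅ := by
  simp [BoundsMod2]

open Classical in
lemma BoundsMod2.symmDiff {F F' : Finset (Finset V)} {E E' : Set (Sym2 V)}
    (h : S.BoundsMod2 F E) (h' : S.BoundsMod2 F' E') :
    S.BoundsMod2 (symmDiff F F') (symmDiff E E') := by
  refine ⟨fun A hA => ?_, fun e => ?_⟩
  · rcases Finset.mem_symmDiff.1 hA with hA | hA
    exacts [h.1 A hA.1, h'.1 A hA.1]
  · have key : ∀ X Y : Finset (Finset V),
        Odd (_root_.symmDiff X Y).card ↔ ¬ (Odd X.card ↔ Odd Y.card) := by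
      intro X Y
      have hd : _root_.symmDiff X Y = (X \ Y) ∪ (Y \ X) := rfl
      rw [hd, Finset.card_union_of_disjoint disjoint_sdiff_sdiff]
      have h₁ := Finset.card_sdiff_add_card_inter X Y
      have h₂ := Finset.card_sdiff_add_card_inter Y X
      rw [Finset.inter_comm] at h₂
      simp only [Nat.odd_iff]
      omega
    have hf : (_root_.symmDiff F F').filter (fun A => e ∈ S.cellEdges A) =
        _root_.symmDiff (F.filter fun A => e ∈ S.cellEdges A)
          (F'.filter fun A => e ∈ S.cellEdges A) := by
      ext A
      simp only [Finset.mem_filter, Finset.mem_symmDiff]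
      tauto
    rw [hf, key, ← h.2, ← h'.2, Set.mem_symmDiff]
    tauto

lemma GraduallyVaried.exists_boundsMod2 {p q : V} {P P' : S.G.Walk p q}
    (h : S.GraduallyVaried P P') :
    ∃ F, S.BoundsMod2 F (symmDiff {e | e ∈ P.edges} {e | e ∈ P'.edges}) := by
  classical
  obtain ⟨F, hF, hodd⟩ := h
  refine ⟨F, fun A hA => (hF A hA).1, fun e => ?_⟩
  have hcard : {A | A ∈ F ∧ e ∈ S.cellEdges A}.ncard =
      (F.filter fun A => e ∈ S.cellEdges A).card := by
    rw [← Set.ncard_coe_finset, Finset.coe_filter]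
  have he := hodd e
  rw [hcard] at he
  rw [Set.mem_symmDiff]
  exact he

/-- In a simply connected surface every simple cycle is the boundary modulo 2 of a finite set of
2-cells. -/
lemma exists_boundsMod2_edges (hsc : S.SimplyConnected) {w : V} {C : S.G.Walk w w}
    (hC : C.IsCycle) : ∃ F, S.BoundsMod2 F {e | e ∈ C.edges} := by
  classical
  -- any second point of the cycle will do for cutting it into two arcs
  have hadj : S.G.Adj w C.snd := C.adj_snd hC.not_nil
  have hq : C.snd ∈ C.support := C.getVert_mem_support 1
  obtain ⟨n, Q, -, h0, hn, hstep⟩ := hsc w C.snd C hq hC hadj.ne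
  have hsum : ∀ i ≤ n, ∃ F,
      S.BoundsMod2 F (symmDiff {e | e ∈ (Q 0).edges} {e | e ∈ (Q i).edges}) := by
    intro i
    induction i with
    | zero => exact fun _ => ⟨∅, by simpa using BoundsMod2.empty⟩
    | succ i ih =>
      intro hi
      obtain ⟨F, hF⟩ := ih (by omega)
      obtain ⟨F', hF'⟩ := (hstep i (by omega)).1.exists_boundsMod2
      refine ⟨_root_.symmDiff F F', ?_⟩
      have hs := hF.symmDiff hF'
      rwa [symmDiff_assoc, symmDiff_symmDiff_cancel_left] at hs
  obtain ⟨F, hF⟩ := hsum n le_rfl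
  refine ⟨F, ?_⟩
  rw [h0, hn] at hF
  have happ : (C.takeUntil C.snd hq).edges ++ (C.dropUntil C.snd hq).edges = C.edges := by
    rw [← SimpleGraph.Walk.edges_append, C.take_spec hq]
  -- the two arcs have no common edge, so their sum modulo 2 is their union
  have hnd := hC.isCircuit.isTrail.edges_nodup
  rw [← happ, List.nodup_append'] at hnd
  convert hF using 1
  ext e
  have hdis : e ∈ (C.takeUntil C.snd hq).edges → e ∉ (C.dropUntil C.snd hq).edges :=
    fun h h' => hnd.2.2 h h'
  rw [← happ]
  simp only [Set.mem_ofPred_eq, List.mem_append, Set.mem_symmDiff,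
    SimpleGraph.Walk.edges_reverse, List.mem_reverse]
  tauto

/-- No third 2-cell contains an edge that two different 2-cells have in common. -/
lemma eq_or_eq_of_mem_edge {u v : V} (huv : S.G.Adj u v) {A B D : Finset V} (hAB : A ≠ B)
    (hA : A ∈ S.cells ∧ u ∈ A ∧ v ∈ A) (hB : B ∈ S.cells ∧ u ∈ B ∧ v ∈ B)
    (hD : D ∈ S.cells ∧ u ∈ D ∧ v ∈ D) : D = A ∨ D = B := by
  have hcard := S.edge_mem u v huv
  have hfin : {A | A ∈ S.cells ∧ u ∈ A ∧ v ∈ A}.Finite :=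
    Set.finite_of_ncard_pos (by omega)
  by_contra! hne
  have hsub : ({D, A, B} : Set (Finset V)) ⊆ {A | A ∈ S.cells ∧ u ∈ A ∧ v ∈ A} := by
    rintro X (rfl | rfl | rfl)
    exacts [hD, hA, hB]
  have h3 : ({D, A, B} : Set (Finset V)).ncard = 3 :=
    Set.ncard_eq_three.2 ⟨D, A, B, hne.1, hne.2, hAB, rfl⟩
  have hle := Set.ncard_le_ncard hsub hfin
  omega

/-- Exactly one of two different 2-cells at an edge belongs to `F` if and only if the edge is in the
boundary of `F`. -/
lemma BoundsMod2.mem_iff_not_mem_iff {F : Finset (Finset V)} {E : Set (Sym2 V)}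
    (h : S.BoundsMod2 F E) {u v : V} (huv : S.G.Adj u v) {A B : Finset V} (hAB : A ≠ B)
    (hA : A ∈ S.cells ∧ u ∈ A ∧ v ∈ A) (hB : B ∈ S.cells ∧ u ∈ B ∧ v ∈ B) :
    s(u, v) ∈ E ↔ ¬ (A ∈ F ↔ B ∈ F) := by
  classical
  have hf : F.filter (fun D => s(u, v) ∈ S.cellEdges D) =
      ({A, B} : Finset (Finset V)).filter (· ∈ F) := by
    ext D
    have hmem : s(u, v) ∈ S.cellEdges D ↔ u ∈ D ∧ v ∈ D := by
      simp [cellEdges, huv]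
    simp only [Finset.mem_filter, hmem, Finset.mem_insert, Finset.mem_singleton]
    constructor
    · rintro ⟨hD, hu, hv⟩
      exact ⟨eq_or_eq_of_mem_edge huv hAB hA hB ⟨h.1 D hD, hu, hv⟩, hD⟩
    · rintro ⟨rfl | rfl, hD⟩
      exacts [⟨hD, hA.2⟩, ⟨hD, hB.2⟩]
  rw [h.2, hf, Finset.filter_insert, Finset.filter_singleton]
  by_cases hAF : A ∈ F <;> by_cases hBF : B ∈ F <;> simp [hAF, hBF, hAB]

/-- All 2-cells around a regular point that is on no edge of the boundary of `F` are on the same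
side. -/
lemma BoundsMod2.mem_iff_of_regularAt {F : Finset (Finset V)} {E : Set (Sym2 V)}
    (h : S.BoundsMod2 F E) {p : V} (hp : S.RegularAt p) (hE : ∀ x, s(p, x) ∉ E)
    {A B : Finset V} (hA : A ∈ S.cells) (hpA : p ∈ A) (hB : B ∈ S.cells) (hpB : p ∈ B) :
    A ∈ F ↔ B ∈ F := by
  have hchain := hp.2 A hA hpA B hB hpB
  clear hB hpB
  induction hchain with
  | refl => rfl
  | @tail X Y _ hXY ih =>
    obtain ⟨hX, hY, x, hpx, hpX, hxX, hpY, hxY⟩ := hXY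
    refine ih.trans ?_
    by_cases hne : X = Y
    · rw [hne]
    · exact not_not.1 fun hn => hE x
        ((h.mem_iff_not_mem_iff hpx hne ⟨hX, hpX, hxX⟩ ⟨hY, hpY, hxY⟩).2 hn)

lemma exists_cell_of_adj {u v : V} (huv : S.G.Adj u v) : ∃ A ∈ S.cells, u ∈ A ∧ v ∈ A := by
  have hcard := S.edge_mem u v huv
  exact Set.nonempty_of_ncard_ne_zero (s := {A | A ∈ S.cells ∧ u ∈ A ∧ v ∈ A}) (by omega)

/-- A walk that avoids all edges of the boundary of `F`, and their endpoints, stays on one side. -/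
lemma BoundsMod2.mem_iff_of_walk {F : Finset (Finset V)} {E : Set (Sym2 V)}
    (h : S.BoundsMod2 F E) (hreg : S.Regular) {a b : V} (P : S.G.Walk a b)
    (hP : ∀ p ∈ P.support, ∀ x, s(p, x) ∉ E) {A B : Finset V}
    (hA : A ∈ S.cells) (haA : a ∈ A) (hB : B ∈ S.cells) (hbB : b ∈ B) :
    A ∈ F ↔ B ∈ F := by
  induction P generalizing A with
  | nil => exact h.mem_iff_of_regularAt (hreg _) (hP _ (by simp)) hA haA hB hbB
  | cons huv P ih =>
    obtain ⟨D, hD, huD, hvD⟩ := exists_cell_of_adj huv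
    exact (h.mem_iff_of_regularAt (hreg _) (hP _ (by simp)) hA haA hD huD).trans
      (ih (fun p hp => hP p (by simp [hp])) hD hvD hbB)

end DiscreteSurface

open DiscreteSurface in
theorem theorem1 {V : Type*} (S : DiscreteSurface V) (hreg : S.Regular) (hor : S.Orientable)
    (hsc : S.SimplyConnected) {w : V} (C : S.G.Walk w w) (hC : S.IsClosedCurve C)
    (hbd : ∀ v ∈ C.support, v ∉ S.boundary) :
    -- `S - C` has at least two components
    Nontrivial (S.minus C).ConnectedComponent ∧
    -- and the two 2-cells at any edge of `C` are on different sides of `C`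
    ∀ u v, s(u, v) ∈ C.edges →
      ∃ A ∈ S.cells, ∃ B ∈ S.cells, A ≠ B ∧ u ∈ A ∧ v ∈ A ∧ u ∈ B ∧ v ∈ B ∧
        (∃ a ∈ A, a ∉ C.support) ∧ (∃ b ∈ B, b ∉ C.support) ∧
        ∀ a ∈ A, a ∉ C.support → ∀ b ∈ B, b ∉ C.support →
          ∀ P : S.G.Walk a b, ∃ x ∈ P.support, x ∈ C.support := by
  obtain ⟨F, hF⟩ := exists_boundsMod2_edges hsc hC.1
  have hsep : ∀ u v, s(u, v) ∈ C.edges →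
      ∃ A ∈ S.cells, ∃ B ∈ S.cells, A ≠ B ∧ u ∈ A ∧ v ∈ A ∧ u ∈ B ∧ v ∈ B ∧
        (∃ a ∈ A, a ∉ C.support) ∧ (∃ b ∈ B, b ∉ C.support) ∧
        ∀ a ∈ A, a ∉ C.support → ∀ b ∈ B, b ∉ C.support →
          ∀ P : S.G.Walk a b, ∃ x ∈ P.support, x ∈ C.support := by
    intro u v he
    have huv : S.G.Adj u v := C.adj_of_mem_edges he
    -- `u` is not a boundary point, so the edge lies in two 2-cells
    have h2 : {A | A ∈ S.cells ∧ u ∈ A ∧ v ∈ A}.ncard = 2 :=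
      (S.edge_mem u v huv).resolve_left fun h1 =>
        hbd u (C.fst_mem_support_of_mem_edges he) ⟨v, huv, h1⟩
    obtain ⟨A, B, hAB, hset⟩ := Set.ncard_eq_two.1 h2
    have hA : A ∈ S.cells ∧ u ∈ A ∧ v ∈ A := by
      change A ∈ {A | A ∈ S.cells ∧ u ∈ A ∧ v ∈ A}
      simp [hset]
    have hB : B ∈ S.cells ∧ u ∈ B ∧ v ∈ B := by
      change B ∈ {A | A ∈ S.cells ∧ u ∈ A ∧ v ∈ A}
      simp [hset]
    refine ⟨A, hA.1, B, hB.1, hAB, hA.2.1, hA.2.2, hB.2.1, hB.2.2, hC.2 A hA.1, hC.2 B hB.1, ?_⟩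
    intro a ha _ b hb _ P
    by_contra! hP
    exact (hF.mem_iff_not_mem_iff huv hAB hA hB).1 he
      (hF.mem_iff_of_walk hreg P
        (fun p hp x hx => hP p hp (C.fst_mem_support_of_mem_edges hx)) hA.1 ha hB.1 hb)
  refine ⟨?_, hsep⟩
  have hfirst : s(w, C.snd) ∈ C.edges := C.mk_start_snd_mem_edges hC.1.not_nil
  obtain ⟨A, -, B, -, -, -, -, -, -, ⟨a, ha, haC⟩, ⟨b, hb, hbC⟩, hcut⟩ := hsep _ _ hfirst
  refine ⟨(S.minus C).connectedComponentMk ⟨a, haC⟩, (S.minus C).connectedComponentMk ⟨b, hbC⟩,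
    fun heq => ?_⟩
  obtain ⟨P⟩ := SimpleGraph.ConnectedComponent.exact heq
  -- a walk in `S - C` is a walk in `G` that avoids `C`
  obtain ⟨x, hx, hxC⟩ :=
    hcut a ha haC b hb hbC (P.map (SimpleGraph.Embedding.induce _).toHom)
  obtain ⟨y, -, rfl⟩ := List.mem_map.1
    ((congrArg (x ∈ ·) (SimpleGraph.Walk.support_map (SimpleGraph.Embedding.induce _).toHom P)).mp hx)
  exact y.2 hxC
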